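/- Let $d_{\mathrm{in}}, d_{\mathrm{out}}$ be positive integers and fix the standard ("incoherent") orthonormal bases of $\mathbb{C}^{d_{\mathrm{in}}}$ and $\mathbb{C}^{d_{\mathrm{out}}}$. On either space let $\Delta(A)=\sum_i |i\rangle\langle i|A|i\rangle\langle i|$ be the dephasing map. A channel is a completely positive trace-preserving linear map $\mathcal{E}:M_{d_{\mathrm{in}}}(\mathbb{C})\to M_{d_{\mathrm{out}}}(\mathbb{C})$. A channel $\mathcal{E}$ is - a dephasing-covariant incoherent operation (DIO) if $\Delta\circ\mathcal{E}=\mathcal{E}\circ\Delta$; - an incoherent operation (IO) if it has a finite Kraus representation $\mathcal{E}(A)=\sum_i K_iAK_i^\dagger$ such that, for every $i$, $K_iAK_i^\dagger$ is diagonal whenever $A$ is diagonal; - a strictly incoherent operation (SIO) if it has a finite Kraus representation $\mathcal{E}(A)=\sum_i K_iAK_i^\dagger$ such that $\Delta(K_iAK_i^\dagger)=K_i\Delta(A)K_i^\dagger$ for every $i$ and every $A$. For real vectors $u,v$, the shorter one extended by zeros so that both have length $d$, write $u\prec v$ if $\sum_{i=1}^k u_i^\downarrow\le\sum_{i=1}^k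 v_i^\downarrow$ for all $k=1,\dots,d$, with equality for $k=d$, where $\downarrow$ denotes arrangement in non-increasing order. Let $|\psi\rangle=\sum_x\mu_x|x\rangle\in\mathbb{C}^{d_{\mathrm{in}}}$ and $|\phi\rangle=\sum_y\nu_y|y\rangle\in\mathbb{C}^{d_{\mathrm{out}}}$ be unit vectors, and put $p_x=|\mu_x|^2$, $q_y=|\nu_y|^2$. Then there is a DIO $\mathcal{E}$ with $\mathcal{E}(|\psi\rangle\langle\psi|)=|\phi\rangle\langle\phi|$ if and only if $p\prec q$. Likewise, there is an IO $\mathcal{E}$ with $\mathcal{E}(|\psi\rangle\langle\psi|)=|\phi\rangle\langle\phi|$ if and only if $p\prec q$, and there is an SIO $\mathcal{E}$ with this property if and only if $p\prec q$. Hence DIO, IO and SIO allow exactly the same deterministic transformations between pure states. -/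

import Mathlib

open scoped Matrix ComplexOrder

noncomputable section

namespace Coherence

/-- Operators on the Hilbert space `ℂ^d`, written in the fixed incoherent basis. -/
abbrev Op (d : ℕ) : Type := Matrix (Fin d) (Fin d) ℂ

/-- The rank-one operator `|ψ⟩⟨ψ|`. -/
def proj {d : ℕ} (ψ : EuclideanSpace ℂ (Fin d)) : Op d :=
  Matrix.of fun i j => ψ i * star (ψ j)

/-- The completely dephasing map `Δ`: it keeps the diagonal and erases all other entries. -/
def dephase {d : ℕ} (A : Op d) : Op d := Matrix.diagonal A.diag

/-- The map `id_k ⊗ E`: `E` is applied to every block of a `k × k` block matrix. -/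
def ampliation {m n : ℕ} (k : ℕ) (E : Op m →ₗ[ℂ] Op n)
    (A : Matrix (Fin k × Fin m) (Fin k × Fin m) ℂ) :
    Matrix (Fin k × Fin n) (Fin k × Fin n) ℂ :=
  Matrix.of fun a b => E (Matrix.of fun x x' => A (a.1, x) (b.1, x')) a.2 b.2

/-- Complete positivity: every `id_k ⊗ E` preserves positive semidefiniteness. -/
def IsCompletelyPositive {m n : ℕ} (E : Op m →ₗ[ℂ] Op n) : Prop :=
  ∀ (k : ℕ) (A : Matrix (Fin k × Fin m) (Fin k × Fin m) ℂ),
    A.PosSemidef → (ampliation k E A).PosSemidef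

/-- A quantum channel: a completely positive and trace-preserving linear map. -/
structure IsChannel {m n : ℕ} (E : Op m →ₗ[ℂ] Op n) : Prop where
  completelyPositive : IsCompletelyPositive E
  tracePreserving : ∀ A, (E A).trace = A.trace

/-- `K` is a (finite) family of Kraus operators of `E`. -/
def IsKraus {m n r : ℕ} (E : Op m →ₗ[ℂ] Op n) (K : Fin r → Matrix (Fin n) (Fin m) ℂ) : Prop :=
  ∀ A, E A = ∑ i, K i * A * (K i)ᴴ

/-- Dephasing-covariant incoherent operations: channels that commute with dephasing. -/
structure IsDIO {m n : ℕ} (E : Op m →ₗ[ℂ] Op n) : Prop where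
  channel : IsChannel E
  covariant : ∀ A, dephase (E A) = E (dephase A)

/-- Incoherent operations: channels with a Kraus representation each of whose Kraus operators
maps diagonal operators to diagonal operators. -/
structure IsIO {m n : ℕ} (E : Op m →ₗ[ℂ] Op n) : Prop where
  channel : IsChannel E
  incoherent : ∃ (r : ℕ) (K : Fin r → Matrix (Fin n) (Fin m) ℂ), IsKraus E K ∧
    ∀ i (A : Op m), A.IsDiag → (K i * A * (K i)ᴴ).IsDiag

/-- Strictly incoherent operations: channels with a Kraus representation each of whose Kraus
operators commutes with dephasing. -/
structure IsSIO {m n : ℕ} (E : Op m →ₗ[ℂ] Op n) : Prop where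
  channel : IsChannel E
  strictlyIncoherent : ∃ (r : ℕ) (K : Fin r → Matrix (Fin n) (Fin m) ℂ), IsKraus E K ∧
    ∀ i (A : Op m), dephase (K i * A * (K i)ᴴ) = K i * dephase A * (K i)ᴴ

/-- The vector `u` extended by trailing zeros to length `d` (used with `m ≤ d`). -/
def zeroPad {m : ℕ} (d : ℕ) (u : Fin m → ℝ) : Fin d → ℝ :=
  fun i => if h : (i : ℕ) < m then u ⟨i, h⟩ else 0

/-- The components of `u` in non-increasing order. -/
def sortDesc {d : ℕ} (u : Fin d → ℝ) : Fin d → ℝ :=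
  fun i => u (Tuple.sort u i.rev)

theorem sortDesc_antitone {d : ℕ} (u : Fin d → ℝ) : Antitone (sortDesc u) :=
  fun _ _ h => Tuple.monotone_sort u (Fin.rev_le_rev.mpr h)

/-- The sum of the `k` largest components of `u`. -/
def topSum {d : ℕ} (u : Fin d → ℝ) (k : ℕ) : ℝ :=
  ∑ i ∈ Finset.univ.filter (fun i : Fin d => i.val < k), sortDesc u i

/-- Majorization `u ≺ v`; the shorter vector is first extended by zeros. -/
def MajorizedBy {m n : ℕ} (u : Fin m → ℝ) (v : Fin n → ℝ) : Prop :=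
  (∀ k ≤ max m n, topSum (zeroPad (max m n) u) k ≤ topSum (zeroPad (max m n) v) k) ∧
    ∑ i, u i = ∑ j, v j

end Coherence

end

/-!
Let `p` and `q` be the squared moduli of the components of `ψ` and `φ`.

Necessity, for DIO and IO alike: a pure output is uncorrelated with the environment, so a
Stinespring dilation `V` of the channel maps `ψ` to `φ ⊗ c`, where `‖c‖ ≤ 1`. Write
`v x y = (⟨y| ⊗ 1) V |x⟩`. In `∑ x ∈ S, p x`, an overlap of `V` applied to the restriction of `ψ`
to `S` with `φ ⊗ c`, the vector `c` may be replaced at each output `y` by any `z y` that has the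
same inner products with the `v x y`, `x ∈ S`, so `∑ x ∈ S, p x ≤ ∑ y, ‖z y‖ ^ 2 * q y` by
Cauchy–Schwarz. Incoherence of the channel allows a choice with `‖z y‖ ≤ 1` and
`∑ y, ‖z y‖ ^ 2 ≤ |S|`, which bounds `∑ x ∈ S, p x` by the sum of the `|S|` largest `q y`.

Sufficiency: `p` is a mixture of rearrangements of `q`, and each rearrangement in the mixture gives
one Kraus operator, with at most one nonzero entry in every row and column, that maps `ψ` to a
multiple of `φ`. Such a channel is an SIO, hence a DIO and an IO.
-/

namespace Coherence

/-! ### Majorization -/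

section Majorization

theorem zeroPad_castLE {m d : ℕ} (h : m ≤ d) (u : Fin m → ℝ) (x : Fin m) :
    zeroPad d u (Fin.castLE h x) = u x := by
  simp [zeroPad]

theorem zeroPad_mem {m d : ℕ} {u : Fin m → ℝ} {s : Set ℝ} (h0 : (0 : ℝ) ∈ s)
    (hu : ∀ x, u x ∈ s) (i : Fin d) : zeroPad d u i ∈ s := by
  unfold zeroPad
  split
  · exact hu _
  · exact h0

theorem sum_mul_zeroPad {m d : ℕ} (h : m ≤ d) (f : Fin d → ℝ) (u : Fin m → ℝ) :
    ∑ i, f i * zeroPad d u i = ∑ x, f (Fin.castLE h x) * u x := by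
  refine (Fintype.sum_of_injective (Fin.castLE h) (Fin.castLE_injective h) _ _ (fun i hi => ?_)
    fun x => by rw [zeroPad_castLE]).symm
  have him : ¬(i : ℕ) < m := fun him => hi ⟨⟨i, him⟩, rfl⟩
  simp [zeroPad, him]

theorem sum_zeroPad {m d : ℕ} (h : m ≤ d) (u : Fin m → ℝ) :
    ∑ i, zeroPad d u i = ∑ x, u x := by
  simpa using sum_mul_zeroPad h (fun _ => 1) u

variable {d : ℕ}

/-- The permutation of indices that arranges `u` in non-increasing order: the largest component
sits at index `sortPerm u 0`. -/
noncomputable def sortPerm (u : Fin d → ℝ) : Equiv.Perm (Fin d) :=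
  Fin.revPerm.trans (Tuple.sort u)

theorem apply_sortPerm (u : Fin d → ℝ) (i : Fin d) : u (sortPerm u i) = sortDesc u i := rfl

theorem exists_card_le_topSum_eq_sum (u : Fin d → ℝ) (k : ℕ) :
    ∃ S : Finset (Fin d), S.card ≤ k ∧ topSum u k = ∑ i ∈ S, u i := by
  refine ⟨({i : Fin d | i.val < k} : Finset (Fin d)).map (sortPerm u).toEmbedding, ?_, ?_⟩
  · rw [Finset.card_map, Fin.card_filter_val_lt]
    exact min_le_right _ _
  · rw [Finset.sum_map]
    rfl

theorem topSum_val_add_one (u : Fin d → ℝ) (j : Fin d) :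
    topSum u (j + 1) = ∑ i ∈ Finset.Iic j, sortDesc u i := by
  refine Finset.sum_congr ?_ fun _ _ => rfl
  ext i
  simp

-- Compare both sides after subtracting the threshold `sortDesc u j` from every component of `u`:
-- then the `j + 1` largest components are the ones that a weight in `[0, 1]` wants to select.
theorem sum_mul_add_mul_sortDesc_le_topSum (u : Fin d → ℝ) {w : Fin d → ℝ} (hw0 : ∀ i, 0 ≤ w i)
    (hw1 : ∀ i, w i ≤ 1) (j : Fin d) :
    ∑ i, w i * u i + (j + 1 - ∑ i, w i) * sortDesc u j ≤ topSum u (j + 1) := by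
  set t := sortDesc u j
  have hpointwise (i : Fin d) :
      w (sortPerm u i) * (sortDesc u i - t) ≤ if i ∈ Finset.Iic j then sortDesc u i - t else 0 := by
    split_ifs with hij
    · exact mul_le_of_le_one_left
        (sub_nonneg.2 (sortDesc_antitone u (Finset.mem_Iic.1 hij))) (hw1 _)
    · have hji : j ≤ i := (not_le.1 fun h => hij (Finset.mem_Iic.2 h)).le
      exact mul_nonpos_of_nonneg_of_nonpos (hw0 _) (sub_nonpos.2 (sortDesc_antitone u hji))
  calc ∑ i, w i * u i + (j + 1 - ∑ i, w i) * t
      = ∑ i, w i * (u i - t) + (j + 1) * t := by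
        simp only [mul_sub, Finset.sum_sub_distrib, ← Finset.sum_mul]
        ring
    _ = ∑ i, w (sortPerm u i) * (sortDesc u i - t) + (j + 1) * t := by
        rw [← Equiv.sum_comp (sortPerm u)]
        simp only [apply_sortPerm]
    _ ≤ ∑ i ∈ Finset.Iic j, (sortDesc u i - t) + (j + 1) * t := by
        rw [← Finset.univ_inter (Finset.Iic j), ← Finset.sum_ite_mem]
        gcongr with i
        exact hpointwise i
    _ = topSum u (j + 1) := by
        simp [topSum_val_add_one]

theorem sum_mul_le_topSum {u w : Fin d → ℝ} {k : ℕ} (hk : k ≤ d) (hu : ∀ i, 0 ≤ u i)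
    (hw0 : ∀ i, 0 ≤ w i) (hw1 : ∀ i, w i ≤ 1) (hwk : ∑ i, w i ≤ k) :
    ∑ i, w i * u i ≤ topSum u k := by
  cases k with
  | zero =>
    have hw : ∑ i, w i = 0 :=
      le_antisymm (by simpa using hwk) (Finset.sum_nonneg fun i _ => hw0 i)
    rw [Fintype.sum_eq_zero_iff_of_nonneg hw0] at hw
    simp [hw, topSum]
  | succ j =>
    have hslack : 0 ≤ ((j : ℝ) + 1 - ∑ i, w i) * sortDesc u ⟨j, hk⟩ :=
      mul_nonneg (sub_nonneg.2 (by exact_mod_cast hwk)) (hu _)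
    exact (le_add_of_nonneg_right hslack).trans
      (sum_mul_add_mul_sortDesc_le_topSum u hw0 hw1 ⟨j, hk⟩)

theorem sum_le_topSum_card (u : Fin d → ℝ) (S : Finset (Fin d)) :
    ∑ i ∈ S, u i ≤ topSum u S.card := by
  rcases hS : S.card with _ | j
  · simp [Finset.card_eq_zero.1 hS, topSum]
  · have hjd : j < d := by
      simpa [hS] using S.card_le_univ
    have h := sum_mul_add_mul_sortDesc_le_topSum u (w := fun i => if i ∈ S then 1 else 0)
      (fun i => by split_ifs <;> simp) (fun i => by split_ifs <;> simp) ⟨j, hjd⟩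
    simpa [hS] using h

theorem majorizedBy_of_exists_weights {m n : ℕ} {p : Fin m → ℝ} {q : Fin n → ℝ}
    (hq : ∀ y, 0 ≤ q y) (hpq : ∑ x, p x = ∑ y, q y)
    (hweights : ∀ S : Finset (Fin m), ∃ w : Fin n → ℝ, (∀ y, 0 ≤ w y) ∧ (∀ y, w y ≤ 1) ∧
      ∑ y, w y ≤ S.card ∧ ∑ x ∈ S, p x ≤ ∑ y, w y * q y) :
    MajorizedBy p q := by
  refine ⟨fun k hk => ?_, hpq⟩
  have hm : m ≤ max m n := le_max_left m n
  have hn : n ≤ max m n := le_max_right m n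
  obtain ⟨T, hTk, hT⟩ := exists_card_le_topSum_eq_sum (zeroPad (max m n) p) k
  set S : Finset (Fin m) := {x | Fin.castLE hm x ∈ T} with hSdef
  have hSk : S.card ≤ k := by
    refine (Finset.card_le_card_of_injOn (Fin.castLE hm) (fun x hx => ?_)
      (Fin.castLE_injective hm).injOn).trans hTk
    simpa [hSdef] using hx
  have hTS : ∑ i ∈ T, zeroPad (max m n) p i = ∑ x ∈ S, p x := by
    simpa [hSdef, Finset.sum_filter] using sum_mul_zeroPad hm (fun i => if i ∈ T then 1 else 0) p
  obtain ⟨w, hw0, hw1, hwS, hw⟩ := hweights S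
  calc topSum (zeroPad (max m n) p) k = ∑ x ∈ S, p x := hT.trans hTS
    _ ≤ ∑ y, w y * q y := hw
    _ = ∑ i, zeroPad (max m n) w i * zeroPad (max m n) q i := by
        simp only [sum_mul_zeroPad hn, zeroPad_castLE]
    _ ≤ topSum (zeroPad (max m n) q) k :=
        sum_mul_le_topSum hk (zeroPad_mem (s := Set.Ici 0) Set.self_mem_Ici hq)
          (zeroPad_mem (s := Set.Ici 0) Set.self_mem_Ici hw0)
          (zeroPad_mem (s := Set.Iic 1) (Set.mem_Iic.2 zero_le_one) hw1)
          (by rw [sum_zeroPad hn]; exact hwS.trans (by exact_mod_cast hSk))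

theorem mul_sum_le_sum_mul_of_antitone {R : Type*} [CommRing R] [LinearOrder R]
    [IsStrictOrderedRing R] {c a : Fin d → R} {t : R} (hc : Antitone c) (ht : ∀ i, t ≤ c i)
    (ha : ∀ k ≤ d, 0 ≤ ∑ i with i.val < k, a i) :
    t * ∑ i, a i ≤ ∑ i, c i * a i := by
  induction d generalizing t with
  | zero => simp
  | succ d ih =>
    have htotal : 0 ≤ ∑ i, a i := by
      simpa [Finset.filter_true_of_mem, Fin.is_le] using ha (d + 1) le_rfl
    have hinit : c (Fin.last d) * ∑ i : Fin d, a i.castSucc ≤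
        ∑ i : Fin d, c i.castSucc * a i.castSucc := by
      refine ih (fun i j hij => hc (Fin.castSucc_le_castSucc_iff.2 hij))
        (fun i => hc (Fin.le_last _)) fun k hk => ?_
      simpa [Finset.sum_filter, Fin.sum_univ_castSucc, hk.not_gt] using ha k (by omega)
    calc t * ∑ i, a i ≤ c (Fin.last d) * ∑ i, a i := by
          gcongr
          exact ht _
      _ ≤ ∑ i, c i * a i := by
          rw [Fin.sum_univ_castSucc, Fin.sum_univ_castSucc, mul_add]
          gcongr

-- By Hahn–Banach it is enough to dominate every linear functional `c`; the mixture of the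
-- rearrangements of `q` that matters is the one in which `q` is ordered in the same way as `c`.
theorem exists_mem_stdSimplex_sum_perm_eq {p q : Fin d → ℝ}
    (hpq : ∀ k ≤ d, topSum p k ≤ topSum q k) (hsum : ∑ i, p i = ∑ i, q i) :
    ∃ l ∈ stdSimplex ℝ (Equiv.Perm (Fin d)), ∀ i, ∑ σ, l σ * q (σ i) = p i := by
  set mix := Fintype.linearCombination ℝ fun σ : Equiv.Perm (Fin d) => q ∘ σ with hmix
  suffices hp : p ∈ mix '' stdSimplex ℝ (Equiv.Perm (Fin d)) by
    obtain ⟨l, hl, rfl⟩ := hp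
    exact ⟨l, hl, fun i => by simp [hmix, Fintype.linearCombination_apply]⟩
  by_contra hp
  have hclosed : IsClosed (mix '' stdSimplex ℝ (Equiv.Perm (Fin d))) :=
    ((isCompact_stdSimplex ℝ _).image mix.continuous_of_finiteDimensional).isClosed
  obtain ⟨f, s, hfs, hsf⟩ := geometric_hahn_banach_closed_point
    ((convex_stdSimplex ℝ _).linear_image mix) hclosed hp
  set c : Fin d → ℝ := fun i => f (Pi.single i 1)
  have hf (u : Fin d → ℝ) : f u = ∑ i, sortDesc c i * u (sortPerm c i) := by
    conv_lhs => rw [pi_eq_sum_univ' u, map_sum, ← Equiv.sum_comp (sortPerm c)]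
    simp only [map_smul, smul_eq_mul, mul_comm, c, ← apply_sortPerm]
  have hfq : ∑ i, sortDesc c i * sortDesc q i < s := by
    have h := hfs _ ⟨_, single_mem_stdSimplex ℝ ((sortPerm c).symm.trans (sortPerm q)), rfl⟩
    simpa [hmix, hf, apply_sortPerm] using h
  have hfp : s < ∑ i, sortDesc c i * p (sortPerm c i) := hf p ▸ hsf
  obtain ⟨t, ht⟩ := Finite.exists_ge (sortDesc c)
  have habel := mul_sum_le_sum_mul_of_antitone (a := fun i => sortDesc q i - p (sortPerm c i))
    (sortDesc_antitone c) ht fun k hk => by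
      rw [Finset.sum_sub_distrib, sub_nonneg]
      have h := sum_le_topSum_card p
        (({i : Fin d | i.val < k} : Finset (Fin d)).map (sortPerm c).toEmbedding)
      rw [Finset.card_map, Fin.card_filter_val_lt, min_eq_right hk, Finset.sum_map] at h
      exact h.trans (hpq k hk)
  have htotal : ∑ i, (sortDesc q i - p (sortPerm c i)) = 0 := by
    rw [Finset.sum_sub_distrib, Equiv.sum_comp (sortPerm c) p, hsum, sub_eq_zero]
    exact Equiv.sum_comp (sortPerm q) q
  rw [htotal, mul_zero] at habel
  simp only [mul_sub, Finset.sum_sub_distrib] at habel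
  linarith

end Majorization

/-! ### Orthogonal families and Gram matrices -/

section InnerProductSpace

variable {𝕜 ι H : Type*} [RCLike 𝕜] [NormedAddCommGroup H] [InnerProductSpace 𝕜 H]
  {V : ι → Submodule 𝕜 H} [∀ i, (V i).HasOrthogonalProjection]

theorem norm_sq_sum_starProjection
    (hV : OrthogonalFamily 𝕜 (fun i => V i) fun i => (V i).subtypeₗᵢ)
    (s : Finset ι) (c : H) :
    ‖∑ i ∈ s, (V i).starProjection c‖ ^ 2 = ∑ i ∈ s, ‖(V i).starProjection c‖ ^ 2 :=
  hV.norm_sum (fun i => (V i).orthogonalProjectionOnto c) s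

theorem inner_sum_starProjection
    (hV : OrthogonalFamily 𝕜 (fun i => V i) fun i => (V i).subtypeₗᵢ) {s : Finset ι} {i : ι}
    (hi : i ∈ s) {v : H} (hv : v ∈ V i) (c : H) :
    inner 𝕜 v (∑ j ∈ s, (V j).starProjection c) = inner 𝕜 v c := by
  have horth (j : ι) (hji : j ≠ i) : inner 𝕜 v ((V j).starProjection c) = 0 :=
    hV hji.symm ⟨v, hv⟩ ((V j).orthogonalProjectionOnto c)
  rw [inner_sum, Finset.sum_eq_single_of_mem i hi fun j _ => horth j,
    ← Submodule.inner_starProjection_left_eq_right, Submodule.starProjection_eq_self_iff.2 hv]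

theorem sum_norm_sq_starProjection_le
    (hV : OrthogonalFamily 𝕜 (fun i => V i) fun i => (V i).subtypeₗᵢ)
    (s : Finset ι) (c : H) :
    ∑ i ∈ s, ‖(V i).starProjection c‖ ^ 2 ≤ ‖c‖ ^ 2 := by
  rw [← norm_sq_sum_starProjection hV]
  set u := ∑ i ∈ s, (V i).starProjection c with hu
  have huu : inner 𝕜 u u = inner 𝕜 u c := by
    nth_rw 1 3 [hu]
    rw [sum_inner, sum_inner]
    exact Finset.sum_congr rfl fun i hi => inner_sum_starProjection hV hi (by simp) c
  have hle : ‖u‖ ^ 2 ≤ ‖u‖ * ‖c‖ := by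
    rw [@norm_sq_eq_re_inner 𝕜, huu]
    exact re_inner_le_norm u c
  nlinarith [sq_nonneg (‖u‖ - ‖c‖)]

theorem orthogonalFamily_span_singleton {v : ι → H}
    (hv : Pairwise fun i j => inner 𝕜 (v i) (v j) = 0) :
    OrthogonalFamily 𝕜 (fun i => 𝕜 ∙ v i) fun i => (𝕜 ∙ v i).subtypeₗᵢ :=
  OrthogonalFamily.of_pairwise fun _ _ hij =>
    Submodule.isOrtho_span.2 (by simpa using hv hij)

-- The vector `c` is a rescaled `w i` with `a i ≠ 0`; when `a = 0`, all `w i` vanish and `c = 0`.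
theorem exists_eq_smul_of_inner_eq_mul_star {w : ι → H} {a : ι → 𝕜}
    (hw : ∀ i j, inner 𝕜 (w j) (w i) = a i * star (a j)) :
    ∃ c : H, ‖c‖ ≤ 1 ∧ ∀ i, w i = a i • c := by
  have hnorm (i : ι) : ‖w i‖ = ‖a i‖ := by
    have h := congrArg norm (hw i i)
    rwa [norm_mul, norm_star, ← sq, inner_self_eq_norm_sq_to_K, norm_pow, RCLike.norm_ofReal,
      abs_norm, pow_left_inj₀ (norm_nonneg _) (norm_nonneg _) two_ne_zero] at h
  by_cases ha : ∃ i₀, a i₀ ≠ 0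
  · obtain ⟨i₀, hi₀⟩ := ha
    refine ⟨(a i₀)⁻¹ • w i₀, by simp [norm_smul, hnorm, hi₀], fun i => ?_⟩
    have hself : inner 𝕜 (a i₀ • w i - a i • w i₀) (a i₀ • w i - a i • w i₀) = 0 := by
      simp only [inner_sub_left, inner_sub_right, inner_smul_left, inner_smul_right, hw,
        RCLike.star_def]
      ring
    rw [smul_comm, eq_inv_smul_iff₀ hi₀]
    exact sub_eq_zero.1 (inner_self_eq_zero.1 hself)
  · push Not at ha
    exact ⟨0, by simp, fun i => by simpa [ha] using hnorm i⟩

end InnerProductSpace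

/-! ### Kraus families -/

section Kraus

variable {m n r : ℕ} {ι : Type*} [Fintype ι]

theorem mul_vecMulVec_star_mul_conjTranspose (K : Matrix (Fin n) (Fin m) ℂ) (a b : Fin m → ℂ) :
    K * Matrix.vecMulVec a (star b) * Kᴴ = Matrix.vecMulVec (K *ᵥ a) (star (K *ᵥ b)) := by
  rw [Matrix.mul_vecMulVec, Matrix.vecMulVec_mul, Matrix.star_mulVec]

theorem proj_eq_vecMulVec (ψ : EuclideanSpace ℂ (Fin m)) :
    proj ψ = Matrix.vecMulVec ψ.ofLp (star ψ.ofLp) := rfl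

theorem trace_proj (ψ : EuclideanSpace ℂ (Fin m)) :
    (proj ψ).trace = ((∑ x, ‖ψ x‖ ^ 2 : ℝ) : ℂ) := by
  simp [proj, Matrix.trace, Complex.mul_conj']

/-- The map `A ↦ ∑ i, K i * A * (K i)ᴴ` with Kraus operators `K`, indexed by an arbitrary
finite type. -/
noncomputable def krausMap (K : ι → Matrix (Fin n) (Fin m) ℂ) : Op m →ₗ[ℂ] Op n where
  toFun A := ∑ i, K i * A * (K i)ᴴ
  map_add' A B := by simp only [Matrix.mul_add, Matrix.add_mul, Finset.sum_add_distrib]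
  map_smul' c A := by simp [Finset.smul_sum]

theorem krausMap_apply (K : ι → Matrix (Fin n) (Fin m) ℂ) (A : Op m) :
    krausMap K A = ∑ i, K i * A * (K i)ᴴ := rfl

theorem krausMap_single_apply (K : ι → Matrix (Fin n) (Fin m) ℂ) (x x' : Fin m) (y y' : Fin n) :
    krausMap K (Matrix.single x x' 1) y y' = ∑ i, K i y x * star (K i y' x') := by
  have hsingle : Matrix.single x x' (1 : ℂ) =
      Matrix.vecMulVec (Pi.single x 1) (star (Pi.single x' 1)) := by
    rw [Matrix.single_eq_single_vecMulVec_single, Pi.star_single, star_one]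
  simp only [krausMap_apply, hsingle, mul_vecMulVec_star_mul_conjTranspose, Matrix.sum_apply,
    Matrix.mulVec_single_one]
  rfl

-- Choi: a spectral decomposition of the image of the maximally entangled state is a Kraus family.
theorem IsCompletelyPositive.exists_isKraus {E : Op m →ₗ[ℂ] Op n} (hE : IsCompletelyPositive E) :
    ∃ (r : ℕ) (K : Fin r → Matrix (Fin n) (Fin m) ℂ), IsKraus E K := by
  set ω : Fin m × Fin m → ℂ := fun z => if z.1 = z.2 then 1 else 0
  obtain ⟨r, v, hv⟩ := Matrix.posSemidef_iff_eq_sum_vecMulVec.1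
    (hE m _ (Matrix.posSemidef_vecMulVec_self_star ω))
  have hblock (x x' : Fin m) :
      (Matrix.of fun z z' => Matrix.vecMulVec ω (star ω) (x, z) (x', z')) =
        Matrix.single x x' (1 : ℂ) := by
    ext z z'
    by_cases hx : x = z <;> by_cases hx' : x' = z' <;>
      simp [Matrix.vecMulVec_apply, ω, hx, hx']
  set K : Fin r → Matrix (Fin n) (Fin m) ℂ := fun i => Matrix.of fun y x => v i (x, y)
  suffices hEK : E = krausMap K from ⟨r, K, fun A => by rw [hEK, krausMap_apply]⟩
  refine Matrix.ext_linearMap _ fun x x' => LinearMap.ext_ring (Matrix.ext fun y y' => ?_)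
  have hchoi : E (Matrix.single x x' 1) y y' = ∑ i, v i (x, y) * star (v i (x', y')) := by
    have h := congrFun (congrFun hv (x, y)) (x', y')
    simp only [ampliation, Matrix.of_apply, hblock, Matrix.sum_apply] at h
    exact h
  exact hchoi.trans (krausMap_single_apply K _ _ _ _).symm

/-- For a Kraus family `K` with Stinespring dilation `V a = ∑ i, K i a ⊗ e i`, the component
`(⟨y| ⊗ 1) V a` of `V a`: the unnormalised state of the environment after output `y`. -/
noncomputable def environment (K : Fin r → Matrix (Fin n) (Fin m) ℂ) (y : Fin n) :
    EuclideanSpace ℂ (Fin m) →ₗ[ℂ] EuclideanSpace ℂ (Fin r) :=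
  Matrix.toEuclideanLin (Matrix.of fun i x => K i y x)

theorem environment_apply (K : Fin r → Matrix (Fin n) (Fin m) ℂ) (y : Fin n)
    (a : EuclideanSpace ℂ (Fin m)) (i : Fin r) :
    environment K y a i = (K i *ᵥ a.ofLp) y := rfl

theorem environment_single_apply (K : Fin r → Matrix (Fin n) (Fin m) ℂ) (y : Fin n) (x : Fin m)
    (i : Fin r) : environment K y (EuclideanSpace.single x 1) i = K i y x := by
  simp [environment_apply]

variable {E : Op m →ₗ[ℂ] Op n} {K : Fin r → Matrix (Fin n) (Fin m) ℂ}

theorem IsKraus.inner_environment (hK : IsKraus E K) (a b : EuclideanSpace ℂ (Fin m))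
    (y y' : Fin n) :
    inner ℂ (environment K y' b) (environment K y a) =
      E (Matrix.vecMulVec a.ofLp (star b.ofLp)) y y' := by
  simp only [hK _, Matrix.sum_apply, mul_vecMulVec_star_mul_conjTranspose, PiLp.inner_apply,
    environment_apply]
  rfl

theorem IsKraus.inner_environment_single (hK : IsKraus E K) (x x' : Fin m) (y y' : Fin n) :
    inner ℂ (environment K y' (EuclideanSpace.single x' 1))
      (environment K y (EuclideanSpace.single x 1)) = E (Matrix.single x x' 1) y y' := by
  rw [hK.inner_environment, Matrix.single_eq_single_vecMulVec_single]
  simp [Pi.star_single]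

theorem IsKraus.sum_inner_environment (hK : IsKraus E K) (hE : ∀ A, (E A).trace = A.trace)
    (a b : EuclideanSpace ℂ (Fin m)) :
    ∑ y, inner ℂ (environment K y b) (environment K y a) = inner ℂ b a := by
  simp only [hK.inner_environment]
  exact (hE _).trans (Matrix.trace_vecMulVec _ _)

theorem IsKraus.sum_norm_sq_environment (hK : IsKraus E K) (hE : ∀ A, (E A).trace = A.trace)
    (a : EuclideanSpace ℂ (Fin m)) : ∑ y, ‖environment K y a‖ ^ 2 = ‖a‖ ^ 2 := by
  simp only [@norm_sq_eq_re_inner ℂ, ← map_sum, hK.sum_inner_environment hE]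

end Kraus

/-! ### Majorization from pure-state transformations -/

section Necessity

variable {m n r : ℕ} {E : Op m →ₗ[ℂ] Op n} {K : Fin r → Matrix (Fin n) (Fin m) ℂ}
  {ψ : EuclideanSpace ℂ (Fin m)} {φ : EuclideanSpace ℂ (Fin n)}

-- A pure output is uncorrelated with the environment: the dilation maps `ψ` to `φ ⊗ c`.
theorem IsKraus.exists_environment_eq_smul (hK : IsKraus E K) (h : E (proj ψ) = proj φ) :
    ∃ c : EuclideanSpace ℂ (Fin r), ‖c‖ ≤ 1 ∧ ∀ y, environment K y ψ = φ y • c :=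
  exists_eq_smul_of_inner_eq_mul_star fun y y' => by
    rw [hK.inner_environment, ← proj_eq_vecMulVec, h]
    rfl

theorem IsKraus.norm_inner_sq_le (hK : IsKraus E K) (hE : ∀ A, (E A).trace = A.trace)
    {c : EuclideanSpace ℂ (Fin r)} (hψ : ∀ y, environment K y ψ = φ y • c)
    {a : EuclideanSpace ℂ (Fin m)} {z : Fin n → EuclideanSpace ℂ (Fin r)}
    (hz : ∀ y, inner ℂ (environment K y a) (z y) = inner ℂ (environment K y a) c) :
    ‖inner ℂ a ψ‖ ^ 2 ≤ ‖a‖ ^ 2 * ∑ y, ‖z y‖ ^ 2 * ‖φ y‖ ^ 2 := by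
  have hinner : inner ℂ a ψ = ∑ y, inner ℂ (environment K y a) (φ y • z y) := by
    simp only [← hK.sum_inner_environment hE ψ a, hψ, inner_smul_right, hz]
  have hnorm : ‖inner ℂ a ψ‖ ≤ ∑ y, ‖environment K y a‖ * (‖z y‖ * ‖φ y‖) := by
    rw [hinner]
    refine norm_sum_le_of_le _ fun y _ => (norm_inner_le_norm _ _).trans_eq ?_
    rw [norm_smul, mul_comm ‖φ y‖]
  calc ‖inner ℂ a ψ‖ ^ 2 ≤ (∑ y, ‖environment K y a‖ * (‖z y‖ * ‖φ y‖)) ^ 2 := by gcongr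
    _ ≤ (∑ y, ‖environment K y a‖ ^ 2) * ∑ y, (‖z y‖ * ‖φ y‖) ^ 2 :=
        Finset.sum_mul_sq_le_sq_mul_sq _ _ _
    _ = ‖a‖ ^ 2 * ∑ y, ‖z y‖ ^ 2 * ‖φ y‖ ^ 2 := by
        simp only [hK.sum_norm_sq_environment hE, mul_pow]

theorem inner_sum_smul_single {S : Finset (Fin m)} {b : EuclideanSpace ℂ (Fin m)}
    (hb : ∀ x ∈ S, b x = ψ x) :
    inner ℂ (∑ x ∈ S, ψ x • EuclideanSpace.single x (1 : ℂ)) b =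
      ((∑ x ∈ S, ‖ψ x‖ ^ 2 : ℝ) : ℂ) := by
  rw [sum_inner, Complex.ofReal_sum]
  refine Finset.sum_congr rfl fun x hx => ?_
  rw [inner_smul_left, EuclideanSpace.inner_single_left, map_one, one_mul, hb x hx,
    Complex.conj_mul', Complex.ofReal_pow]

theorem norm_sq_sum_smul_single (ψ : EuclideanSpace ℂ (Fin m)) (S : Finset (Fin m)) :
    ‖∑ x ∈ S, ψ x • EuclideanSpace.single x (1 : ℂ)‖ ^ 2 = ∑ x ∈ S, ‖ψ x‖ ^ 2 := by
  rw [@norm_sq_eq_re_inner ℂ,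
    inner_sum_smul_single fun x hx => by simp [Pi.single_apply, hx]]
  exact Complex.ofReal_re _

-- The previous inequality for `a` the restriction of `ψ` to `S`, where both `‖a‖ ^ 2` and
-- `⟨a, ψ⟩` are the probability of `S`.
theorem IsKraus.sum_norm_sq_le (hK : IsKraus E K) (hE : ∀ A, (E A).trace = A.trace)
    {c : EuclideanSpace ℂ (Fin r)} (hψ : ∀ y, environment K y ψ = φ y • c)
    {S : Finset (Fin m)} {z : Fin n → EuclideanSpace ℂ (Fin r)}
    (hz : ∀ x ∈ S, ∀ y, inner ℂ (environment K y (EuclideanSpace.single x 1)) (z y) =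
      inner ℂ (environment K y (EuclideanSpace.single x 1)) c) :
    ∑ x ∈ S, ‖ψ x‖ ^ 2 ≤ ∑ y, ‖z y‖ ^ 2 * ‖φ y‖ ^ 2 := by
  have hle := hK.norm_inner_sq_le hE hψ (z := z)
    (a := ∑ x ∈ S, ψ x • EuclideanSpace.single x (1 : ℂ)) fun y => by
      simp only [map_sum, map_smul, sum_inner, inner_smul_left]
      exact Finset.sum_congr rfl fun x hx => by rw [hz x hx y]
  rw [inner_sum_smul_single fun _ _ => rfl, norm_sq_sum_smul_single, Complex.norm_real,
    Real.norm_eq_abs, sq_abs, pow_two (∑ x ∈ S, _)] at hle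
  have hs0 : 0 ≤ ∑ x ∈ S, ‖ψ x‖ ^ 2 := by positivity
  obtain hs | hs := hs0.eq_or_lt
  · rw [← hs]
    positivity
  · exact le_of_mul_le_mul_left hle hs

theorem IsKraus.majorizedBy (hK : IsKraus E K) (hE : ∀ A, (E A).trace = A.trace)
    (h : E (proj ψ) = proj φ)
    (hz : ∀ (S : Finset (Fin m)) (c : EuclideanSpace ℂ (Fin r)), ‖c‖ ≤ 1 →
      ∃ z : Fin n → EuclideanSpace ℂ (Fin r), (∀ y, ‖z y‖ ^ 2 ≤ 1) ∧ ∑ y, ‖z y‖ ^ 2 ≤ S.card ∧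
        ∀ x ∈ S, ∀ y, inner ℂ (environment K y (EuclideanSpace.single x 1)) (z y) =
          inner ℂ (environment K y (EuclideanSpace.single x 1)) c) :
    MajorizedBy (fun x => ‖ψ x‖ ^ 2) fun y => ‖φ y‖ ^ 2 := by
  have htrace : ∑ x, ‖ψ x‖ ^ 2 = ∑ y, ‖φ y‖ ^ 2 := by
    have htr := hE (proj ψ)
    rw [h, trace_proj, trace_proj] at htr
    exact_mod_cast htr.symm
  obtain ⟨c, hc, hψ⟩ := hK.exists_environment_eq_smul h
  refine majorizedBy_of_exists_weights (fun y => sq_nonneg _) htrace fun S => ?_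
  obtain ⟨z, hz1, hzS, hzc⟩ := hz S c hc
  exact ⟨fun y => ‖z y‖ ^ 2, fun y => sq_nonneg _, hz1, hzS, hK.sum_norm_sq_le hE hψ hzc⟩

theorem IsDIO.map_single_apply_self (hE : IsDIO E) {x x' : Fin m} (hx : x ≠ x') (y : Fin n) :
    E (Matrix.single x x' 1) y y = 0 := by
  have hdephase : dephase (Matrix.single x x' (1 : ℂ)) = 0 := by
    rw [dephase, Matrix.diag_single_of_ne _ _ _ hx]
    exact Matrix.diagonal_zero
  have h := congrFun (congrFun (hE.covariant (Matrix.single x x' 1)) y) y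
  rwa [hdephase, map_zero, dephase, Matrix.diagonal_apply_eq] at h

theorem IsDIO.map_single_self_apply (hE : IsDIO E) (x : Fin m) {y y' : Fin n} (hy : y ≠ y') :
    E (Matrix.single x x 1) y y' = 0 := by
  have hdephase : dephase (Matrix.single x x (1 : ℂ)) = Matrix.single x x 1 := by
    rw [dephase, Matrix.diag_single_same, Matrix.diagonal_single]
  have h := congrFun (congrFun (hE.covariant (Matrix.single x x 1)) y) y'
  rwa [hdephase, dephase, Matrix.diagonal_apply_ne _ hy, eq_comm] at h

-- For a DIO the vectors `environment K y (single x 1)` are orthogonal both for distinct `x` and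
-- for distinct `y`, so both bounds on `z` are instances of Bessel's inequality.
theorem IsDIO.majorizedBy (hE : IsDIO E) (h : E (proj ψ) = proj φ) :
    MajorizedBy (fun x => ‖ψ x‖ ^ 2) fun y => ‖φ y‖ ^ 2 := by
  obtain ⟨r, K, hK⟩ := hE.channel.completelyPositive.exists_isKraus
  set v : Fin m → Fin n → EuclideanSpace ℂ (Fin r) := fun x y =>
    environment K y (EuclideanSpace.single x 1)
  have horthIn (y : Fin n) := orthogonalFamily_span_singleton (𝕜 := ℂ) (v := fun x => v x y)
    fun x x' hx => (hK.inner_environment_single x' x y y).trans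
      (hE.map_single_apply_self hx.symm y)
  have horthOut (x : Fin m) := orthogonalFamily_span_singleton (𝕜 := ℂ) (v := v x)
    fun y y' hy => (hK.inner_environment_single x x y' y).trans
      (hE.map_single_self_apply x hy.symm)
  refine hK.majorizedBy hE.channel.tracePreserving h fun S c hc => ?_
  have hc2 : ‖c‖ ^ 2 ≤ 1 := pow_le_one₀ (norm_nonneg c) hc
  refine ⟨fun y => ∑ x ∈ S, (ℂ ∙ v x y).starProjection c, fun y => ?_, ?_, fun x hx y =>
    inner_sum_starProjection (horthIn y) hx (Submodule.mem_span_singleton_self _) c⟩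
  · rw [norm_sq_sum_starProjection (horthIn y)]
    exact (sum_norm_sq_starProjection_le (horthIn y) S c).trans hc2
  · simp only [norm_sq_sum_starProjection (horthIn _)]
    rw [Finset.sum_comm]
    calc ∑ x ∈ S, ∑ y, ‖(ℂ ∙ v x y).starProjection c‖ ^ 2 ≤ ∑ _ ∈ S, (1 : ℝ) :=
          Finset.sum_le_sum fun x _ => (sum_norm_sq_starProjection_le (horthOut x) _ c).trans hc2
      _ = S.card := by simp

theorem subsingleton_support_col_of_isDiag {K : Matrix (Fin n) (Fin m) ℂ}
    (hK : ∀ A : Op m, A.IsDiag → (K * A * Kᴴ).IsDiag) (x : Fin m) :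
    {y | K y x ≠ 0}.Subsingleton := by
  intro y hy y' hy'
  by_contra hne
  have hdiag := hK (Matrix.diagonal (Pi.single x 1)) (Matrix.isDiag_diagonal _) hne
  rw [Matrix.diagonal_single, Matrix.single_eq_single_vecMulVec_single] at hdiag
  simp_all [Matrix.mul_vecMulVec, Matrix.vecMulVec_mul, Matrix.vecMulVec_apply]

-- The Kraus operator `K i` sends the basis vectors in `S` into the span of at most `S.card` basis
-- vectors; `z y` keeps the components `i` of `c` for which `y` is one of them.
theorem IsIO.majorizedBy (hE : IsIO E) (h : E (proj ψ) = proj φ) :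
    MajorizedBy (fun x => ‖ψ x‖ ^ 2) fun y => ‖φ y‖ ^ 2 := by
  obtain ⟨r, K, hK, hinc⟩ := hE.incoherent
  refine hK.majorizedBy hE.channel.tracePreserving h fun S c hc => ?_
  have hc2 : ∑ i, ‖c i‖ ^ 2 ≤ 1 := by
    rw [← EuclideanSpace.norm_sq_eq]
    exact pow_le_one₀ (norm_nonneg c) hc
  set T : Fin r → Finset (Fin n) := fun i => S.biUnion fun x => {y | K i y x ≠ 0}
  have hTS (i : Fin r) : (T i).card ≤ S.card := by
    refine (Finset.card_biUnion_le_card_mul S _ 1 fun x _ =>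
      Finset.card_le_one_iff_subsingleton.2 ?_).trans_eq (mul_one _)
    simpa using subsingleton_support_col_of_isDiag (hinc i) x
  set z : Fin n → EuclideanSpace ℂ (Fin r) := fun y =>
    WithLp.toLp 2 fun i => if y ∈ T i then c i else 0 with hz
  have hznorm (y : Fin n) : ‖z y‖ ^ 2 = ∑ i, if y ∈ T i then ‖c i‖ ^ 2 else 0 := by
    rw [EuclideanSpace.norm_sq_eq]
    exact Finset.sum_congr rfl fun i _ => by simp only [hz]; split_ifs <;> simp
  refine ⟨z, fun y => ?_, ?_, fun x hx y => ?_⟩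
  · rw [hznorm]
    exact (Finset.sum_le_sum fun i _ => by split_ifs <;> simp).trans hc2
  · calc ∑ y, ‖z y‖ ^ 2 = ∑ i, (T i).card * ‖c i‖ ^ 2 := by
          simp only [hznorm]
          rw [Finset.sum_comm]
          simp
      _ ≤ ∑ i, S.card * ‖c i‖ ^ 2 := by
          gcongr with i
          exact hTS i
      _ ≤ S.card := by
          rw [← Finset.mul_sum]
          exact mul_le_of_le_one_right (Nat.cast_nonneg _) hc2
  · simp only [PiLp.inner_apply, environment_single_apply, hz]
    refine Finset.sum_congr rfl fun i _ => ?_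
    by_cases hi : K i y x = 0
    · simp [hi]
    · have hy : y ∈ T i := Finset.mem_biUnion.2 ⟨x, hx, by simpa using hi⟩
      rw [if_pos hy]

end Necessity

/-! ### Strictly incoherent channels from monomial Kraus operators -/

section StrictlyIncoherent

variable {m n : ℕ} {ι : Type*} [Fintype ι]

theorem ampliation_krausMap (K : ι → Matrix (Fin n) (Fin m) ℂ) (k : ℕ)
    (A : Matrix (Fin k × Fin m) (Fin k × Fin m) ℂ) :
    ampliation k (krausMap K) A =
      ∑ i, Matrix.kronecker (1 : Matrix (Fin k) (Fin k) ℂ) (K i) * A *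
        (Matrix.kronecker (1 : Matrix (Fin k) (Fin k) ℂ) (K i))ᴴ := by
  ext a b
  simp only [ampliation, krausMap_apply, Matrix.of_apply, Matrix.sum_apply]
  refine Finset.sum_congr rfl fun i _ => ?_
  simp [Matrix.mul_apply, Fintype.sum_prod_type, Matrix.kroneckerMap_apply, Matrix.one_apply,
    Finset.sum_mul, apply_ite (starRingEnd ℂ), Finset.sum_ite_irrel]

theorem isCompletelyPositive_krausMap (K : ι → Matrix (Fin n) (Fin m) ℂ) :
    IsCompletelyPositive (krausMap K) := fun k A hA => by
  rw [ampliation_krausMap]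
  exact Matrix.posSemidef_sum _ fun i _ => hA.mul_mul_conjTranspose_same _

theorem isChannel_krausMap {K : ι → Matrix (Fin n) (Fin m) ℂ} (hK : ∑ i, (K i)ᴴ * K i = 1) :
    IsChannel (krausMap K) := by
  refine ⟨isCompletelyPositive_krausMap K, fun A => ?_⟩
  calc (krausMap K A).trace = ∑ i, ((K i)ᴴ * K i * A).trace := by
        rw [krausMap_apply, Matrix.trace_sum]
        exact Finset.sum_congr rfl fun i _ => by rw [Matrix.trace_mul_comm, Matrix.mul_assoc]
    _ = A.trace := by rw [← Matrix.trace_sum, ← Finset.sum_mul, hK, one_mul]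

theorem isKraus_krausMap (K : ι → Matrix (Fin n) (Fin m) ℂ) :
    IsKraus (krausMap K) (K ∘ (Fintype.equivFin ι).symm) := fun A =>
  (Equiv.sum_comp (Fintype.equivFin ι).symm fun i => K i * A * (K i)ᴴ).symm

theorem krausMap_proj {K : ι → Matrix (Fin n) (Fin m) ℂ} {c : ι → ℂ}
    {ψ : EuclideanSpace ℂ (Fin m)} {φ : EuclideanSpace ℂ (Fin n)} (hc : ∑ i, ‖c i‖ ^ 2 = 1)
    (hK : ∀ i, K i *ᵥ ψ.ofLp = c i • φ.ofLp) : krausMap K (proj ψ) = proj φ := by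
  have hterm (i : ι) : K i * proj ψ * (K i)ᴴ = ((‖c i‖ ^ 2 : ℝ) : ℂ) • proj φ := by
    rw [proj_eq_vecMulVec, mul_vecMulVec_star_mul_conjTranspose, hK, star_smul,
      Matrix.smul_vecMulVec, Matrix.vecMulVec_smul, smul_smul, RCLike.star_def, Complex.mul_conj',
      Complex.ofReal_pow, proj_eq_vecMulVec]
  simp only [krausMap_apply, hterm]
  rw [← Finset.sum_smul, ← Complex.ofReal_sum, hc, Complex.ofReal_one, one_smul]

theorem dephase_mul_mul_conjTranspose {K : Matrix (Fin n) (Fin m) ℂ}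
    (hrow : ∀ y, {x | K y x ≠ 0}.Subsingleton) (hcol : ∀ x, {y | K y x ≠ 0}.Subsingleton)
    (A : Op m) : dephase (K * A * Kᴴ) = K * dephase A * Kᴴ := by
  ext y y'
  have hright : (K * dephase A * Kᴴ) y y' = ∑ x, K y x * A x x * star (K y' x) := by
    rw [dephase, Matrix.mul_apply]
    simp only [Matrix.mul_diagonal, Matrix.conjTranspose_apply, Matrix.diag_apply]
  rw [hright]
  by_cases hy : y = y'
  · subst hy
    rw [dephase, Matrix.diagonal_apply_eq, Matrix.diag_apply, Matrix.mul_apply]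
    refine Finset.sum_congr rfl fun x _ => ?_
    rw [Matrix.conjTranspose_apply]
    by_cases hx : K y x = 0
    · simp [hx]
    · congr 1
      rw [Matrix.mul_apply]
      refine Fintype.sum_eq_single x fun x' hx' => ?_
      rw [not_not.1 fun h => hx' (hrow y h hx), zero_mul]
  · rw [dephase, Matrix.diagonal_apply_ne _ hy]
    refine (Finset.sum_eq_zero fun x _ => ?_).symm
    by_cases hx : K y x = 0
    · simp [hx]
    · rw [not_not.1 fun h => hy (hcol x hx h), star_zero, mul_zero]

theorem sum_conjTranspose_mul_self_eq_one {K : ι → Matrix (Fin n) (Fin m) ℂ}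
    (hrow : ∀ i y, {x | K i y x ≠ 0}.Subsingleton) (hnorm : ∀ x, ∑ i, ∑ y, ‖K i y x‖ ^ 2 = 1) :
    ∑ i, (K i)ᴴ * K i = 1 := by
  ext x x'
  simp only [Matrix.sum_apply, Matrix.mul_apply, Matrix.conjTranspose_apply]
  by_cases hx : x = x'
  · subst hx
    simp only [RCLike.star_def, Complex.conj_mul', Matrix.one_apply_eq]
    exact_mod_cast hnorm x
  · rw [Matrix.one_apply_ne hx]
    refine Finset.sum_eq_zero fun i _ => Finset.sum_eq_zero fun y _ => ?_
    by_cases h : K i y x = 0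
    · simp [h]
    · rw [not_not.1 fun h' => hx (hrow i y h h'), mul_zero]

theorem isSIO_krausMap {K : ι → Matrix (Fin n) (Fin m) ℂ}
    (hrow : ∀ i y, {x | K i y x ≠ 0}.Subsingleton) (hcol : ∀ i x, {y | K i y x ≠ 0}.Subsingleton)
    (hnorm : ∀ x, ∑ i, ∑ y, ‖K i y x‖ ^ 2 = 1) : IsSIO (krausMap K) where
  channel := isChannel_krausMap (sum_conjTranspose_mul_self_eq_one hrow hnorm)
  strictlyIncoherent :=
    ⟨_, _, isKraus_krausMap K, fun _ => dephase_mul_mul_conjTranspose (hrow _) (hcol _)⟩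

theorem dephase_sum (A : ι → Op n) : dephase (∑ i, A i) = ∑ i, dephase (A i) := by
  simp only [dephase, Matrix.diag_sum]
  exact map_sum (Matrix.diagonalAddMonoidHom (Fin n) ℂ) _ _

variable {E : Op m →ₗ[ℂ] Op n}

theorem IsSIO.isIncoherentOperation (hE : IsSIO E) : IsIO E := by
  obtain ⟨r, K, hK, hcov⟩ := hE.strictlyIncoherent
  refine ⟨hE.channel, r, K, hK, fun i A hA => ?_⟩
  have hdephase : dephase A = A := hA.diagonal_diag
  rw [← hdephase, ← hcov]
  exact Matrix.isDiag_diagonal _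

theorem IsSIO.isDephasingCovariant (hE : IsSIO E) : IsDIO E := by
  obtain ⟨r, K, hK, hcov⟩ := hE.strictlyIncoherent
  refine ⟨hE.channel, fun A => ?_⟩
  simp only [hK _, dephase_sum, hcov]

end StrictlyIncoherent

/-! ### Pure-state transformations from majorization -/

section Sufficiency

variable {m n d : ℕ}

/-- The operator that sends the amplitude of `ψ` at `x` to the amplitude of `φ` at the position
`σ x`, both index sets being regarded as initial segments of `Fin d`. Columns `x` with `ψ x = 0`
vanish, because `φ y / 0 = 0`. -/
noncomputable def rearrange (hm : m ≤ d) (hn : n ≤ d) (ψ : EuclideanSpace ℂ (Fin m))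
    (φ : EuclideanSpace ℂ (Fin n)) (σ : Equiv.Perm (Fin d)) : Matrix (Fin n) (Fin m) ℂ :=
  Matrix.of fun y x => if σ (Fin.castLE hm x) = Fin.castLE hn y then φ y / ψ x else 0

/-- The Kraus family for `ψ ↦ φ` attached to weights `l` on the rearrangements. The second half of
the index set restores trace preservation by resetting each basis vector outside the support of
`ψ` to the basis vector `y₀`. -/
noncomputable def rearrangementKraus (hm : m ≤ d) (hn : n ≤ d) (ψ : EuclideanSpace ℂ (Fin m))
    (φ : EuclideanSpace ℂ (Fin n)) (l : Equiv.Perm (Fin d) → ℝ) (y₀ : Fin n) :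
    Equiv.Perm (Fin d) ⊕ Fin m → Matrix (Fin n) (Fin m) ℂ :=
  Sum.elim (fun σ => (Real.sqrt (l σ) : ℂ) • rearrange hm hn ψ φ σ)
    fun z => if ψ z = 0 then Matrix.single y₀ z 1 else 0

variable (hm : m ≤ d) (hn : n ≤ d) {ψ : EuclideanSpace ℂ (Fin m)} {φ : EuclideanSpace ℂ (Fin n)}
  {l : Equiv.Perm (Fin d) → ℝ}

theorem castLE_eq_of_rearrange_ne_zero {σ : Equiv.Perm (Fin d)} {x : Fin m} {y : Fin n}
    (h : rearrange hm hn ψ φ σ y x ≠ 0) : σ (Fin.castLE hm x) = Fin.castLE hn y := by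
  by_contra hne
  exact h (if_neg hne)

theorem rearrangementKraus_row_subsingleton (y₀ : Fin n) (i : Equiv.Perm (Fin d) ⊕ Fin m)
    (y : Fin n) : {x | rearrangementKraus hm hn ψ φ l y₀ i y x ≠ 0}.Subsingleton := by
  intro x hx x' hx'
  rcases i with σ | z
  · exact Fin.castLE_injective hm (σ.injective
      ((castLE_eq_of_rearrange_ne_zero hm hn (right_ne_zero_of_mul hx)).trans
        (castLE_eq_of_rearrange_ne_zero hm hn (right_ne_zero_of_mul hx')).symm))
  · simp only [rearrangementKraus, Sum.elim_inr, Set.mem_ofPred_eq] at hx hx'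
    split_ifs at hx hx' <;> simp_all [Matrix.single_apply]

theorem rearrangementKraus_col_subsingleton (y₀ : Fin n) (i : Equiv.Perm (Fin d) ⊕ Fin m)
    (x : Fin m) : {y | rearrangementKraus hm hn ψ φ l y₀ i y x ≠ 0}.Subsingleton := by
  intro y hy y' hy'
  rcases i with σ | z
  · exact Fin.castLE_injective hn
      ((castLE_eq_of_rearrange_ne_zero hm hn (right_ne_zero_of_mul hy)).symm.trans
        (castLE_eq_of_rearrange_ne_zero hm hn (right_ne_zero_of_mul hy')))
  · simp only [rearrangementKraus, Sum.elim_inr, Set.mem_ofPred_eq] at hy hy'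
    split_ifs at hy hy' <;> simp_all [Matrix.single_apply]

theorem sum_norm_sq_rearrange (σ : Equiv.Perm (Fin d)) (x : Fin m) :
    ∑ y, ‖rearrange hm hn ψ φ σ y x‖ ^ 2 =
      zeroPad d (fun y => ‖φ y‖ ^ 2) (σ (Fin.castLE hm x)) / ‖ψ x‖ ^ 2 := by
  have h := sum_mul_zeroPad hn (fun k => if σ (Fin.castLE hm x) = k then 1 else 0)
    fun y => ‖φ y‖ ^ 2
  simp only [ite_mul, one_mul, zero_mul, Finset.sum_ite_eq, Finset.mem_univ, if_true] at h
  rw [h, Finset.sum_div]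
  refine Finset.sum_congr rfl fun y _ => ?_
  rw [rearrange, Matrix.of_apply]
  split_ifs <;> simp [div_pow]

theorem sum_norm_sq_rearrangementKraus (hl : ∀ σ, 0 ≤ l σ)
    (hp : ∀ i, ∑ σ, l σ * zeroPad d (fun y => ‖φ y‖ ^ 2) (σ i) = zeroPad d (fun x => ‖ψ x‖ ^ 2) i)
    (y₀ : Fin n) (x : Fin m) :
    ∑ i, ∑ y, ‖rearrangementKraus hm hn ψ φ l y₀ i y x‖ ^ 2 = 1 := by
  have hrearrange (σ : Equiv.Perm (Fin d)) :
      ∑ y, ‖rearrangementKraus hm hn ψ φ l y₀ (Sum.inl σ) y x‖ ^ 2 =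
        l σ * zeroPad d (fun y => ‖φ y‖ ^ 2) (σ (Fin.castLE hm x)) / ‖ψ x‖ ^ 2 := by
    simp only [rearrangementKraus, Sum.elim_inl, Matrix.smul_apply, norm_smul, mul_pow,
      Complex.norm_real, Real.norm_eq_abs, sq_abs, Real.sq_sqrt (hl σ)]
    rw [← Finset.mul_sum, sum_norm_sq_rearrange, mul_div_assoc]
  have hreset (z : Fin m) : ∑ y, ‖rearrangementKraus hm hn ψ φ l y₀ (Sum.inr z) y x‖ ^ 2 =
      if z = x ∧ ψ x = 0 then 1 else 0 := by
    have hentry (y : Fin n) : ‖rearrangementKraus hm hn ψ φ l y₀ (Sum.inr z) y x‖ ^ 2 =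
        if y₀ = y then if z = x ∧ ψ x = 0 then 1 else 0 else 0 := by
      rw [rearrangementKraus, Sum.elim_inr]
      rcases eq_or_ne z x with rfl | hz
      · by_cases hψ : ψ z = 0 <;> by_cases hy : y₀ = y <;> simp [hψ, hy]
      · by_cases hψ : ψ z = 0 <;> simp [hψ, hz]
    simp [hentry]
  rw [Fintype.sum_sum_type]
  simp only [hrearrange, hreset]
  rw [← Finset.sum_div, hp, zeroPad_castLE]
  by_cases hx : ψ x = 0 <;> simp [hx]

theorem exists_castLE_eq_of_weight_ne_zero (hl : ∀ σ, 0 ≤ l σ)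
    (hp : ∀ i, ∑ σ, l σ * zeroPad d (fun y => ‖φ y‖ ^ 2) (σ i) = zeroPad d (fun x => ‖ψ x‖ ^ 2) i)
    {σ : Equiv.Perm (Fin d)} (hσ : l σ ≠ 0) {y : Fin n} (hy : φ y ≠ 0) :
    ∃ x, ψ x ≠ 0 ∧ σ (Fin.castLE hm x) = Fin.castLE hn y := by
  set i := σ.symm (Fin.castLE hn y) with hi
  have hpos : 0 < zeroPad d (fun x => ‖ψ x‖ ^ 2) i := by
    rw [← hp]
    refine Finset.sum_pos' (fun τ _ => mul_nonneg (hl τ)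
      (zeroPad_mem (s := Set.Ici 0) Set.self_mem_Ici (fun y => sq_nonneg ‖φ y‖) _))
      ⟨σ, Finset.mem_univ σ, mul_pos ((hl σ).lt_of_ne' hσ) ?_⟩
    rw [hi, Equiv.apply_symm_apply, zeroPad_castLE]
    positivity
  have him : (i : ℕ) < m := by
    by_contra him
    simp [zeroPad, him] at hpos
  refine ⟨⟨i, him⟩, fun h0 => ?_, (Equiv.eq_symm_apply _).1 rfl⟩
  simp [zeroPad, him, h0] at hpos

theorem rearrange_mulVec {σ : Equiv.Perm (Fin d)}
    (hσ : ∀ y, φ y ≠ 0 → ∃ x, ψ x ≠ 0 ∧ σ (Fin.castLE hm x) = Fin.castLE hn y) :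
    rearrange hm hn ψ φ σ *ᵥ ψ.ofLp = φ.ofLp := by
  ext y
  by_cases hy : φ y = 0
  · simp [Matrix.mulVec, dotProduct, rearrange, hy]
  · obtain ⟨x, hx, hxy⟩ := hσ y hy
    calc ∑ x', rearrange hm hn ψ φ σ y x' * ψ x' = rearrange hm hn ψ φ σ y x * ψ x := by
          refine Fintype.sum_eq_single x fun x' hx' => ?_
          rw [not_not.1 fun h => hx' (Fin.castLE_injective hm (σ.injective
            ((castLE_eq_of_rearrange_ne_zero hm hn h).trans hxy.symm))), zero_mul]
      _ = φ y := by
          rw [rearrange, Matrix.of_apply, if_pos hxy, div_mul_cancel₀ _ hx]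

theorem rearrangementKraus_mulVec (hl : ∀ σ, 0 ≤ l σ)
    (hp : ∀ i, ∑ σ, l σ * zeroPad d (fun y => ‖φ y‖ ^ 2) (σ i) = zeroPad d (fun x => ‖ψ x‖ ^ 2) i)
    (y₀ : Fin n) (i : Equiv.Perm (Fin d) ⊕ Fin m) :
    rearrangementKraus hm hn ψ φ l y₀ i *ᵥ ψ.ofLp =
      Sum.elim (fun σ => (Real.sqrt (l σ) : ℂ)) (fun _ => 0) i • φ.ofLp := by
  rcases i with σ | z
  · simp only [rearrangementKraus, Sum.elim_inl, Matrix.smul_mulVec]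
    by_cases hσ : l σ = 0
    · simp [hσ]
    · rw [rearrange_mulVec hm hn fun y =>
        exists_castLE_eq_of_weight_ne_zero hm hn hl hp hσ]
  · simp only [rearrangementKraus, Sum.elim_inr, zero_smul]
    split_ifs with hz
    · rw [Matrix.single_mulVec, hz]
      simp
    · exact Matrix.zero_mulVec _

theorem exists_isSIO_of_majorizedBy [NeZero n]
    (h : MajorizedBy (fun x => ‖ψ x‖ ^ 2) fun y => ‖φ y‖ ^ 2) :
    ∃ E : Op m →ₗ[ℂ] Op n, IsSIO E ∧ E (proj ψ) = proj φ := by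
  have hm : m ≤ max m n := le_max_left m n
  have hn : n ≤ max m n := le_max_right m n
  obtain ⟨l, ⟨hl0, hl1⟩, hp⟩ := exists_mem_stdSimplex_sum_perm_eq h.1
    (by rw [sum_zeroPad hm, sum_zeroPad hn, h.2])
  refine ⟨krausMap (rearrangementKraus hm hn ψ φ l 0),
    isSIO_krausMap (rearrangementKraus_row_subsingleton hm hn 0)
      (rearrangementKraus_col_subsingleton hm hn 0)
      (sum_norm_sq_rearrangementKraus hm hn hl0 hp 0),
    krausMap_proj ?_ (rearrangementKraus_mulVec hm hn hl0 hp 0)⟩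
  simpa [Real.sq_sqrt (hl0 _)] using hl1

end Sufficiency

end Coherence

open Coherence in
theorem theorem1_general {dIn dOut : ℕ} [NeZero dOut]
    (ψ : EuclideanSpace ℂ (Fin dIn)) (φ : EuclideanSpace ℂ (Fin dOut)) :
    List.TFAE [∃ E : Op dIn →ₗ[ℂ] Op dOut, IsDIO E ∧ E (proj ψ) = proj φ,
      ∃ E : Op dIn →ₗ[ℂ] Op dOut, IsIO E ∧ E (proj ψ) = proj φ,
      ∃ E : Op dIn →ₗ[ℂ] Op dOut, IsSIO E ∧ E (proj ψ) = proj φ,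
      MajorizedBy (fun x => ‖ψ x‖ ^ 2) fun y => ‖φ y‖ ^ 2] := by
  tfae_have 1 → 4 := fun ⟨_, hE, h⟩ => hE.majorizedBy h
  tfae_have 2 → 4 := fun ⟨_, hE, h⟩ => hE.majorizedBy h
  tfae_have 3 → 1 := fun ⟨E, hE, h⟩ => ⟨E, hE.isDephasingCovariant, h⟩
  tfae_have 3 → 2 := fun ⟨E, hE, h⟩ => ⟨E, hE.isIncoherentOperation, h⟩
  tfae_have 4 → 3 := exists_isSIO_of_majorizedBy
  tfae_finish

theorem theorem1 {dIn dOut : ℕ}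
    (ψ : EuclideanSpace ℂ (Fin dIn)) (φ : EuclideanSpace ℂ (Fin dOut))
    (hψ : ‖ψ‖ = 1) (hφ : ‖φ‖ = 1) :
    ((∃ E : Coherence.Op dIn →ₗ[ℂ] Coherence.Op dOut, Coherence.IsDIO E ∧ E (Coherence.proj ψ) = Coherence.proj φ) ↔
      Coherence.MajorizedBy (fun x => ‖ψ x‖ ^ 2) (fun y => ‖φ y‖ ^ 2)) ∧
    ((∃ E : Coherence.Op dIn →ₗ[ℂ] Coherence.Op dOut, Coherence.IsIO E ∧ E (Coherence.proj ψ) = Coherence.proj φ) ↔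
      Coherence.MajorizedBy (fun x => ‖ψ x‖ ^ 2) (fun y => ‖φ y‖ ^ 2)) ∧
    ((∃ E : Coherence.Op dIn →ₗ[ℂ] Coherence.Op dOut, Coherence.IsSIO E ∧ E (Coherence.proj ψ) = Coherence.proj φ) ↔
      Coherence.MajorizedBy (fun x => ‖ψ x‖ ^ 2) (fun y => ‖φ y‖ ^ 2)) := by
  have : NeZero dOut := ⟨by rintro rfl; simp [Subsingleton.elim φ 0] at hφ⟩
  have h := theorem1_general ψ φ
  exact ⟨h.out 0 3, h.out 1 3, h.out 2 3⟩
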